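/- Let $n\ge 2$ and $k\ge 0$ be integers, and let $$f(x)=\sum_{i=0}^{n}c_i\frac{x^i}{i!}\in\mathbb{Q}[x],$$ where $c_i\in\mathbb{Z}$ for all $0\le i\le n$, $c_n=1$, and $c_0=2^k$ or $c_0=-2^k$. Then the following hold. (i) Either $f$ is irreducible over $\mathbb{Q}$, or $$f(x)=g(x)\prod_{i=1}^{n-\deg g}\bigl(x+\varepsilon_i 2^{t_i}\bigr)$$ for some irreducible polynomial $g\in\mathbb{Q}[x]$, some signs $\varepsilon_i\in\{1,-1\}$ and some nonnegative integers $t_i$ $(1\le i\le n-\deg g)$, where $\frac n2<\deg g<n$ if $n\ge 3$, and $\deg g=1$ if $n=2$. (ii) If $n$ is not of the form $2^s$ with $s$ a positive integer, or if $c_0=\pm1$, then $f$ is irreducible over $\mathbb{Q}$. -/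

import Mathlib

open Polynomial

/-- The rational polynomial `∑_{i=0}^n c_i x^i / i!`. Only `c 0, …, c n` matter. -/
noncomputable def expSum (n : ℕ) (c : ℕ → ℤ) : ℚ[X] :=
  ∑ i ∈ Finset.range (n + 1), C ((c i : ℚ) / (Nat.factorial i : ℚ)) * X ^ i

/-! The argument is Schur's. Let `G` be a monic integral factor of `F = n! f`, of degree `m ≤ n /
2`. By the Sylvester–Schur theorem some prime `p > m` divides one of `n, …, n - m + 1`, and it has
two incompatible effects on `G(0)`.

Modulo `p` a power of `X` larger than the degree of the cofactor divides `F`, so `p ∣ G(0)`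
(`dvd_coeff_zero_of_dvd_intExpSum`). On the other hand, if `p ∣ G(0)`, a root `θ` of `G` has
valuation at least `1 / m ≥ 1 / (p - 1)` at some prime over `p`, while `i!` has valuation at most
`(i - 1) / (p - 1)`. Every term of `f(θ)` with `i > 0` then has positive valuation, which forces `p
∣ c 0` (`not_dvd_coeff_zero_of_dvd_intExpSum`).

For `m ≥ 2` the prime is odd and cannot divide `±2 ^ k`, so only linear factors can split off. Two
of them would make a quadratic factor, so at most one does when `n ≥ 4`. Its constant term has no
odd prime divisor. If `n` has an odd prime divisor or `c 0 = ±1`, the same argument excludes linear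
factors.

Sylvester–Schur follows Erdős: if no prime above `k` divides `n.choose k`, the binomial coefficient
is too small, apart from a range settled by computation. -/

/-! ### Explicit logarithmic estimates -/

theorem Real.one_third_le_log_three_halves : 1 / 3 ≤ Real.log (3 / 2) := by
  have := Real.one_sub_inv_le_log_of_pos (show (0 : ℝ) < 3 / 2 by norm_num)
  norm_num at this ⊢
  linarith

theorem Real.one_le_log_three : 1 ≤ Real.log 3 := by
  rw [Real.le_log_iff_exp_le (by norm_num)]
  exact Real.exp_one_lt_d9.le.trans (by norm_num)

theorem Real.log_three_le : Real.log 3 ≤ 1.14 := by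
  have h := Real.log_le_sub_one_of_pos (show (0 : ℝ) < 3 / 4 by norm_num)
  rw [Real.log_div (by norm_num) (by norm_num), show (4 : ℝ) = 2 ^ 2 by norm_num,
    Real.log_pow] at h
  have := Real.log_two_lt_d9
  norm_num at h ⊢
  linarith

/-- The graph of the logarithm lies below its tangent at `a`. -/
theorem Real.log_le_div_add_log_sub_one {x a : ℝ} (hx : 0 < x) (ha : 0 < a) :
    Real.log x ≤ x / a + Real.log a - 1 := by
  have h := Real.log_le_sub_one_of_pos (div_pos hx ha)
  rw [Real.log_div hx.ne' ha.ne'] at h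
  linarith

/-- Here `z` plays the role of the sixth root of `n`. -/
theorem Real.log_three_add_mul_log_lt {z j : ℝ} (hz : 65536 ≤ z ^ 6) (hz0 : 0 < z)
    (hj : z ^ 4 ≤ j) (hj3 : 3 * j ≤ z ^ 6) :
    Real.log 3 + z ^ 3 * Real.log (z ^ 6) < j * Real.log (z ^ 6 / (2 * j)) := by
  have hz6 : 6 ≤ z := by
    by_contra! h
    have : z ^ 6 ≤ 6 ^ 6 := pow_le_pow_left₀ hz0.le h.le 6
    norm_num at this
    linarith
  have hx : 256 ≤ z ^ 3 := by
    by_contra! h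
    have : (z ^ 3) ^ 2 < 256 ^ 2 := pow_lt_pow_left₀ h (by positivity) (by norm_num)
    rw [← pow_mul] at this
    norm_num at this
    linarith
  have hj0 : 0 < j := lt_of_lt_of_le (by positivity) hj
  have h3 := Real.log_three_le
  have h3' := Real.one_le_log_three
  have h2 := Real.log_two_lt_d9
  have hmono : ∀ c : ℝ, 0 < c → 2 * c * j ≤ z ^ 6 →
      Real.log c ≤ Real.log (z ^ 6 / (2 * j)) := by
    intro c hc h
    refine Real.log_le_log hc ?_
    rw [le_div_iff₀ (by positivity)]
    linarith
  have hlog256 : Real.log 256 ≤ 5.55 := by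
    rw [show (256 : ℝ) = 2 ^ 8 by norm_num, Real.log_pow]
    norm_num at h2 ⊢
    linarith
  have hlogx : Real.log (z ^ 6) ≤ z ^ 3 / 128 + 9.1 := by
    have h := Real.log_le_div_add_log_sub_one (x := z ^ 3) (a := 256) (by positivity) (by norm_num)
    rw [show z ^ 6 = (z ^ 3) ^ 2 by ring, Real.log_pow]
    push_cast
    linarith
  -- Settles `j ≥ n / 18`, where the right side is linear in `n = z ^ 6` and the left is of order
  -- `√n log n`.
  have large : z ^ 6 / 18 ≤ j * Real.log (z ^ 6 / (2 * j)) →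
      Real.log 3 + z ^ 3 * Real.log (z ^ 6) < j * Real.log (z ^ 6 / (2 * j)) := by
    intro h
    refine lt_of_lt_of_le ?_ h
    have : z ^ 3 * Real.log (z ^ 6) ≤ z ^ 3 * (z ^ 3 / 128 + 9.1) := by gcongr
    rw [show z ^ 6 = (z ^ 3) ^ 2 by ring] at this ⊢
    nlinarith
  rcases le_or_gt (z ^ 6) (6 * j) with h6 | h6
  · refine large ?_
    have h1 := hmono (3 / 2) (by norm_num) (by linarith)
    have h4 : 1 / 3 ≤ Real.log (z ^ 6 / (2 * j)) := Real.one_third_le_log_three_halves.trans h1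
    nlinarith
  rcases le_or_gt (z ^ 6) (18 * j) with h18 | h18
  · refine large ?_
    have h1 := hmono 3 (by norm_num) (by linarith)
    have h4 : 1 ≤ Real.log (z ^ 6 / (2 * j)) := h3'.trans h1
    nlinarith
  -- Here only `j ≥ z ^ 4` is available, but the logarithm is at least 2; the tangent at 6 bounds
  -- `log n` linearly in `z`.
  · have h1 := hmono 9 (by norm_num) (by linarith)
    have h9 : 2 ≤ Real.log 9 := by
      rw [show (9 : ℝ) = 3 ^ 2 by norm_num, Real.log_pow]
      push_cast
      linarith
    have hlog6 : Real.log 6 ≤ 1.84 := by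
      rw [show (6 : ℝ) = 2 * 3 by norm_num, Real.log_mul (by norm_num) (by norm_num)]
      norm_num at h2 h3 ⊢
      linarith
    have hlz : Real.log (z ^ 6) ≤ z + 5.04 := by
      have h := Real.log_le_div_add_log_sub_one (x := z) (a := 6) hz0 (by norm_num)
      rw [Real.log_pow]
      push_cast
      linarith
    calc Real.log 3 + z ^ 3 * Real.log (z ^ 6) ≤ 1.14 + z ^ 3 * (z + 5.04) := by gcongr
      _ < z ^ 4 * 2 := by
        rw [show z ^ 4 = z ^ 3 * z by ring]
        nlinarith
      _ ≤ j * Real.log (z ^ 6 / (2 * j)) := by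
        have := h9.trans h1
        gcongr

theorem Nat.three_mul_pow_sqrt_lt {n j : ℕ} (hn : 65536 ≤ n) (hj : n ^ 2 ≤ j ^ 3)
    (hj3 : 3 * j ≤ n) : 3 * (n ^ n.sqrt * 4 ^ j) * j ^ j < (2 * n) ^ j := by
  have hj0 : 0 < j := by
    rcases Nat.eq_zero_or_pos j with rfl | h
    · simp at hj; omega
    · exact h
  have hn0 : (0 : ℝ) < n := by exact_mod_cast (by omega : 0 < n)
  have hj0' : (0 : ℝ) < j := by exact_mod_cast hj0
  obtain ⟨z, hz0, hz⟩ : ∃ z : ℝ, 0 < z ∧ z ^ 6 = n := by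
    refine ⟨(n : ℝ) ^ ((6 : ℕ) : ℝ)⁻¹, by positivity, ?_⟩
    exact Real.rpow_inv_natCast_pow hn0.le (by norm_num)
  have hzj : z ^ 4 ≤ j := by
    refine le_of_pow_le_pow_left₀ (n := 3) (by norm_num) hj0'.le ?_
    calc (z ^ 4) ^ 3 = (n : ℝ) ^ 2 := by rw [← hz]; ring
      _ ≤ (j : ℝ) ^ 3 := by exact_mod_cast hj
  have hs : (n.sqrt : ℝ) ≤ z ^ 3 := by
    refine le_of_pow_le_pow_left₀ (n := 2) (by norm_num) (by positivity) ?_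
    calc (n.sqrt : ℝ) ^ 2 ≤ n := by exact_mod_cast Nat.sqrt_le' n
      _ = (z ^ 3) ^ 2 := by rw [← hz]; ring
  have key := Real.log_three_add_mul_log_lt (z := z) (j := j)
    (by rw [hz]; exact_mod_cast hn) hz0 hzj (by rw [hz]; exact_mod_cast hj3)
  rw [hz] at key
  have hlogn : 0 ≤ Real.log n := Real.log_natCast_nonneg n
  have key2 : Real.log 3 + n.sqrt * Real.log n < j * Real.log (n / (2 * j)) :=
    lt_of_le_of_lt (by gcongr) key
  have : Real.log (3 * ((n : ℝ) ^ n.sqrt * 4 ^ j) * (j : ℝ) ^ j) < Real.log ((2 * (n : ℝ)) ^ j) := by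
    rw [Real.log_mul (by positivity) (by positivity), Real.log_mul (by positivity) (by positivity),
      Real.log_mul (by positivity) (by positivity), Real.log_pow, Real.log_pow, Real.log_pow,
      Real.log_pow, Real.log_mul (by norm_num) hn0.ne', show (4 : ℝ) = 2 * 2 by norm_num,
      Real.log_mul (by norm_num) (by norm_num)]
    rw [Real.log_div hn0.ne' (by positivity), Real.log_mul (by norm_num) hj0'.ne'] at key2
    linarith
  exact_mod_cast (Real.log_lt_log_iff (by positivity) (by positivity)).1 this

/-! ### The Sylvester–Schur theorem -/

/-- Each prime power exactly dividing `n.choose k` is at most `n`. -/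
theorem Nat.choose_le_pow_primeCounting {n k : ℕ} (hn : 0 < n) (hkn : k ≤ n)
    (h : ∀ p, p.Prime → p ∣ n.choose k → p ≤ k) :
    n.choose k ≤ n ^ Nat.primeCounting k := by
  have h0 : n.choose k ≠ 0 := Nat.choose_ne_zero hkn
  calc n.choose k = ∏ p ∈ (n.choose k).primeFactors, p ^ (n.choose k).factorization p := by
        conv_lhs => rw [← Nat.prod_factorization_pow_eq_self h0]
        rw [Nat.prod_factorization_eq_prod_primeFactors]
    _ ≤ ∏ p ∈ (n.choose k).primeFactors, n :=
        Finset.prod_le_prod' fun p _ => Nat.pow_factorization_choose_le hn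
    _ = n ^ (n.choose k).primeFactors.card := by rw [Finset.prod_const]
    _ ≤ n ^ Nat.primeCounting k := by
        refine Nat.pow_le_pow_right hn ?_
        rw [← Nat.primesLE_card_eq_primeCounting]
        refine Finset.card_le_card fun p hp => ?_
        rw [Nat.mem_primeFactors] at hp
        exact Nat.mem_primesLE.2 ⟨h p hp.1 hp.2.1, hp.1⟩

/-- Compare factor by factor: `(a - i) / (n - i) ≤ a / n`. -/
theorem Nat.choose_mul_pow_le {a n : ℕ} (han : a ≤ n) (j : ℕ) :
    a.choose j * n ^ j ≤ n.choose j * a ^ j := by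
  have key : a.descFactorial j * n ^ j ≤ n.descFactorial j * a ^ j := by
    rw [Nat.descFactorial_eq_prod_range, Nat.descFactorial_eq_prod_range,
      ← Finset.card_range j, ← Finset.prod_const, ← Finset.prod_const, Finset.card_range,
      ← Finset.prod_mul_distrib, ← Finset.prod_mul_distrib]
    refine Finset.prod_le_prod' fun i _ => ?_
    rw [Nat.sub_mul, Nat.sub_mul, mul_comm n a]
    exact Nat.sub_le_sub_left (Nat.mul_le_mul_left i han) _
  rw [Nat.descFactorial_eq_factorial_mul_choose, Nat.descFactorial_eq_factorial_mul_choose,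
    mul_assoc, mul_assoc] at key
  exact Nat.le_of_mul_le_mul_left key (Nat.factorial_pos j)

theorem Nat.choose_three_mul_succ (k : ℕ) :
    (3 * (k + 1)).choose (k + 1) * ((2 * k + 2) * (2 * k + 1)) =
      (3 * k).choose k * (3 * ((3 * k + 1) * (3 * k + 2))) := by
  have h1 := Nat.choose_mul_factorial_mul_factorial (show k ≤ 3 * k by omega)
  have h2 := Nat.choose_mul_factorial_mul_factorial (show k + 1 ≤ 3 * (k + 1) by omega)
  rw [show 3 * k - k = 2 * k by omega] at h1
  rw [show 3 * (k + 1) - (k + 1) = 2 * k + 1 + 1 by omega,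
    show 3 * (k + 1) = 3 * k + 1 + 1 + 1 by omega] at h2
  simp only [Nat.factorial_succ] at h2
  have hpos : 0 < (k + 1) * (k.factorial * (2 * k).factorial) := by positivity
  refine Nat.eq_of_mul_eq_mul_right hpos ?_
  rw [show 3 * (k + 1) = 3 * k + 1 + 1 + 1 by omega]
  rw [← h1] at h2
  linear_combination h2

/-- Successive ratios of `(3 * k).choose k` tend to `27 / 4` and exceed 6 from `k = 4` on; the
factor 3 absorbs the start. -/
theorem Nat.six_pow_le_three_mul_choose (k : ℕ) : 6 ^ k ≤ 3 * (3 * k).choose k := by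
  rcases lt_or_ge k 4 with hk | hk
  · interval_cases k <;> decide
  induction k, hk using Nat.le_induction with
  | base => decide
  | succ k hk ih =>
    have h := Nat.choose_three_mul_succ k
    have h3 : 6 * ((2 * k + 2) * (2 * k + 1)) ≤ 3 * ((3 * k + 1) * (3 * k + 2)) := by nlinarith
    refine Nat.le_of_mul_le_mul_right (c := (2 * k + 2) * (2 * k + 1)) ?_ (by positivity)
    calc 6 ^ (k + 1) * ((2 * k + 2) * (2 * k + 1))
        = 6 ^ k * (6 * ((2 * k + 2) * (2 * k + 1))) := by ring
      _ ≤ (3 * (3 * k).choose k) * (3 * ((3 * k + 1) * (3 * k + 2))) := Nat.mul_le_mul ih h3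
      _ = 3 * ((3 * (k + 1)).choose (k + 1)) * ((2 * k + 2) * (2 * k + 1)) := by
        rw [mul_assoc, ← h, mul_assoc]

theorem Nat.choose_le_choose_of_le_half {n i j : ℕ} (hij : i ≤ j) (hj : 2 * j ≤ n) :
    n.choose i ≤ n.choose j := by
  induction j, hij using Nat.le_induction with
  | base => exact le_rfl
  | succ j _ ih =>
    exact (ih (by omega)).trans (Nat.choose_le_succ_of_lt_half_left (by omega))

/-- Primes up to `√n` contribute at most `n` each. Larger ones occur at most once and, by
Kummer-type cancellation, not at all in `(n / 3, k]`, so the primorial bound applies. -/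
theorem Nat.choose_le_pow_sqrt_mul_four_pow {n k : ℕ} (hn : 9 ≤ n) (hkn : 2 * k ≤ n)
    (h : ∀ p, p.Prime → p ∣ n.choose k → p ≤ k) :
    n.choose k ≤ n ^ n.sqrt * 4 ^ min k (n / 3) := by
  have h0 : n.choose k ≠ 0 := Nat.choose_ne_zero (by omega)
  set S := (n.choose k).primeFactors
  calc n.choose k = ∏ p ∈ S, p ^ (n.choose k).factorization p := by
        conv_lhs => rw [← Nat.prod_factorization_pow_eq_self h0]
        rw [Nat.prod_factorization_eq_prod_primeFactors]
    _ = (∏ p ∈ S with p ≤ n.sqrt, p ^ (n.choose k).factorization p) *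
        ∏ p ∈ S with ¬ p ≤ n.sqrt, p ^ (n.choose k).factorization p :=
        (Finset.prod_filter_mul_prod_filter_not _ _ _).symm
    _ ≤ n ^ n.sqrt * 4 ^ min k (n / 3) := by
        refine Nat.mul_le_mul ?_ (le_trans ?_ (primorial_le_four_pow _))
        · refine (Finset.prod_le_prod' fun p _ =>
            Nat.pow_factorization_choose_le (by omega : 0 < n)).trans ?_
          rw [Finset.prod_const]
          refine Nat.pow_le_pow_right (by omega) ?_
          calc _ ≤ (Finset.Icc 1 n.sqrt).card := by
                refine Finset.card_le_card fun p hp => ?_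
                simp only [Finset.mem_filter, S, Nat.mem_primeFactors] at hp
                exact Finset.mem_Icc.2 ⟨hp.1.1.one_lt.le, hp.2⟩
            _ = n.sqrt := by simp
        · rw [primorial_eq_prod_primesLE]
          have hexp : ∀ p ∈ S.filter (fun p => ¬ p ≤ n.sqrt), p.Prime ∧
              (n.choose k).factorization p ≤ 1 ∧ p ≤ min k (n / 3) := by
            intro p hp
            simp only [Finset.mem_filter, S, Nat.mem_primeFactors, not_le] at hp
            obtain ⟨⟨hp, hd, -⟩, hs⟩ := hp
            have hpk := h p hp hd
            refine ⟨hp, Nat.factorization_choose_le_one (Nat.sqrt_lt'.1 hs), le_min hpk ?_⟩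
            by_contra hlt
            have h2 : p ≠ 2 := by
              rintro rfl
              have : 3 ≤ n.sqrt := Nat.le_sqrt.2 (by omega)
              omega
            have := Nat.factorization_choose_of_lt_three_mul (n := n) h2 hpk (by omega) (by omega)
            exact absurd ((hp.dvd_iff_one_le_factorization h0).1 hd) (by omega)
          calc _ ≤ ∏ p ∈ S.filter (fun p => ¬ p ≤ n.sqrt), p := by
                refine Finset.prod_le_prod' fun p hp => ?_
                obtain ⟨hp, h1, -⟩ := hexp p hp
                calc p ^ _ ≤ p ^ 1 := Nat.pow_le_pow_right hp.pos h1
                  _ = p := pow_one p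
            _ ≤ _ := by
                refine Finset.prod_le_prod_of_subset_of_one_le' (fun p hp => ?_)
                  (fun p hp _ => (Nat.prime_of_mem_primesLE hp).one_lt.le)
                obtain ⟨hp, -, h1⟩ := hexp p hp
                exact Nat.mem_primesLE.2 ⟨h1, hp⟩

theorem Nat.three_mul_primeCounting_le {k : ℕ} (hk : 37 ≤ k) : 3 * Nat.primeCounting k ≤ k := by
  rcases lt_or_ge k 160 with h | h
  · have : ∀ k < 160, 37 ≤ k → 3 * Nat.primeCounting k ≤ k := by decide +kernel
    exact this k h hk
  -- Primes above 37 are coprime to 30, a set of density `8 / 30 < 1 / 3`; from 160 on this margin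
  -- covers the initial terms.
  · have h1 := Nat.primeCounting_add_le (a := 30) (k := 37) (by norm_num) (by norm_num) (k - 37)
    have h2 : Nat.primeCounting 37 = 12 := by decide +kernel
    have h3 : Nat.totient 30 = 8 := by decide +kernel
    rw [Nat.add_sub_cancel' hk, h2, h3] at h1
    omega

/-- If `n.choose k` has no prime factor exceeding `k`, then `n` is small compared to `k`. -/
theorem Nat.pow_sub_primeCounting_le {n k : ℕ} (hk : 0 < k) (hkn : k ≤ n)
    (h : ∀ p, p.Prime → p ∣ n.choose k → p ≤ k) :
    n ^ (k - Nat.primeCounting k) ≤ k ^ k := by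
  have hn : 0 < n := by omega
  have h1 := Nat.choose_le_pow_primeCounting hn hkn h
  have h2 := Nat.choose_mul_pow_le hkn k
  rw [Nat.choose_self, one_mul] at h2
  have hpi : Nat.primeCounting k ≤ k := by
    rw [← Nat.primesLE_card_eq_primeCounting, Nat.primesLE_eq_filter_Icc_one]
    exact (Finset.card_filter_le _ _).trans (by simp)
  refine le_of_mul_le_mul_left (a := n ^ Nat.primeCounting k) ?_ (by positivity)
  rw [← pow_add, Nat.add_sub_cancel' hpi]
  exact h2.trans (Nat.mul_le_mul_right _ h1)

theorem Nat.sq_le_cube_of_choose {n k : ℕ} (hk : 37 ≤ k) (hkn : k ≤ n)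
    (h : ∀ p, p.Prime → p ∣ n.choose k → p ≤ k) : n ^ 2 ≤ k ^ 3 := by
  have h1 := Nat.pow_sub_primeCounting_le (by omega) hkn h
  have h2 := Nat.three_mul_primeCounting_le hk
  refine (Nat.pow_le_pow_iff_left (n := k) (by omega)).1 ?_
  calc (n ^ 2) ^ k = n ^ (2 * k) := by rw [← pow_mul]
    _ ≤ n ^ (3 * (k - Nat.primeCounting k)) := Nat.pow_le_pow_right (by omega) (by omega)
    _ = (n ^ (k - Nat.primeCounting k)) ^ 3 := by rw [← pow_mul, mul_comm]
    _ ≤ (k ^ k) ^ 3 := Nat.pow_le_pow_left h1 3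
    _ = (k ^ 3) ^ k := by rw [← pow_mul, ← pow_mul, mul_comm]

theorem Nat.exists_prime_mod_lt_of_small {n k : ℕ} (hk : 2 ≤ k) (hk' : k < 37) (hkn : 2 * k ≤ n)
    (h : n ^ (k - Nat.primeCounting k) ≤ k ^ k) : ∃ p, p.Prime ∧ k < p ∧ n % p < k := by
  have hn : n < 211 := by
    by_contra hn
    have h1 : ∀ k < 37, 2 ≤ k → k ^ k < 211 ^ (k - Nat.primeCounting k) := by decide +kernel
    exact absurd (h1 k hk' hk)
      (not_lt.2 ((Nat.pow_le_pow_left (not_lt.1 hn) _).trans h))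
  let l : List ℕ := [3, 5, 7, 11, 13, 17, 19, 23, 29, 31, 37, 41, 43, 47, 53, 59, 61, 67, 71, 73, 79,
    83, 89, 97, 101, 103, 107, 109, 113, 127, 131, 137, 139, 149, 151, 157, 163, 167, 173, 179, 181,
    191, 193, 197, 199]
  have hl : ∀ p ∈ l, p.Prime := by norm_num [l]
  have h2 : ∀ k < 37, 2 ≤ k → ∀ n < 211, 2 * k ≤ n → n ^ (k - Nat.primeCounting k) ≤ k ^ k →
      l.any fun p => k < p ∧ n % p < k := by decide +kernel
  obtain ⟨p, hp, h3⟩ := List.any_eq_true.1 (h2 k hk' hk n hn hkn h)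
  exact ⟨p, hl p hp, of_decide_eq_true h3⟩

theorem List.exists_rel_of_isChain {R : ℕ → ℕ → Prop} {n : ℕ} (l : List ℕ) (a : ℕ)
    (hl : (a :: l).IsChain R) (ha : a ≤ n) (hn : ∃ b ∈ l, n < b) :
    ∃ q ∈ a :: l, ∃ r, R q r ∧ q ≤ n ∧ n < r := by
  induction l generalizing a with
  | nil => simp at hn
  | cons b l ih =>
    rw [List.isChain_cons_cons] at hl
    rcases lt_or_ge n b with hb | hb
    · exact ⟨a, by simp, b, hl.1, ha, hb⟩
    · obtain ⟨c, hc, hnc⟩ := hn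
      obtain ⟨q, hq, r, h⟩ := ih b hl.2 hb ⟨c, by
        rcases List.mem_cons.1 hc with rfl | hc
        · omega
        · exact hc, hnc⟩
      exact ⟨q, List.mem_cons_of_mem _ hq, r, h⟩

/-- A chain of primes with gaps of order `q ^ (2 / 3)`, matching `n ^ 2 ≤ k ^ 3`: the prime found
lies among the top `k` integers. -/
theorem Nat.exists_prime_near {n : ℕ} (hn : 73 ≤ n) (hn' : n < 65536) :
    ∃ p, p.Prime ∧ p ≤ n ∧ (n - p) ^ 3 ≤ p ^ 2 := by
  let l : List ℕ := [89, 109, 131, 157, 181, 211, 241, 277, 317, 359, 409, 463, 523, 587, 653, 727,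
    797, 883, 971, 1069, 1171, 1283, 1399, 1523, 1637, 1759, 1901, 2053, 2213, 2383, 2557, 2741,
    2927, 3121, 3331, 3547, 3779, 4021, 4273, 4523, 4793, 5077, 5351, 5657, 5953, 6277, 6607, 6959,
    7321, 7699, 8089, 8467, 8867, 9293, 9733, 10181, 10651, 11131, 11621, 12119, 12647, 13187,
    13729, 14303, 14891, 15497, 16111, 16747, 17401, 18061, 18749, 19447, 20161, 20899, 21649,
    22409, 23203, 24007, 24821, 25667, 26513, 27397, 28297, 29221, 30169, 31139, 32119, 33119,
    34147, 35171, 36241, 37337, 38453, 39581, 40739, 41911, 43117, 44293, 45541, 46817, 48109,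
    49429, 50773, 52127, 53507, 54919, 56359, 57829, 59281, 60793, 62327, 63863, 65449, 65537]
  have hc : (73 :: l).IsChain fun q r => (r - 1 - q) ^ 3 ≤ q ^ 2 := by decide +kernel
  have hp : ∀ p ∈ 73 :: l, p.Prime := by norm_num [l]
  obtain ⟨q, hq, r, hqr, h1, h2⟩ :=
    List.exists_rel_of_isChain l 73 hc hn ⟨65537, by decide +kernel, by omega⟩
  exact ⟨q, hp q hq, h1, (Nat.pow_le_pow_left (by omega) 3).trans hqr⟩

theorem Nat.exists_prime_gt_dvd_choose_of_large {n k : ℕ} (hn : 65536 ≤ n) (hkn : 2 * k ≤ n)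
    (h2 : n ^ 2 ≤ k ^ 3) : ∃ p, p.Prime ∧ k < p ∧ p ∣ n.choose k := by
  by_contra! h
  have h : ∀ p, p.Prime → p ∣ n.choose k → p ≤ k := fun p hp hd =>
    not_lt.1 fun hlt => h p hp hlt hd
  -- Both bounds are compared at `j`: the upper one involves `4 ^ j`, and the lower one needs `3 * j
  -- ≤ n`.
  set j := min k (n / 3) with hj
  have hj3 : 3 * j ≤ n := by omega
  have hj2 : n ^ 2 ≤ j ^ 3 := by
    rcases min_choice k (n / 3) with h' | h'
    · rwa [hj, h']
    · rw [hj, h']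
      have h4 : n ≤ 4 * (n / 3) := by omega
      nlinarith [Nat.pow_le_pow_left h4 2, Nat.pow_le_pow_left h4 3, show 64 ≤ n / 3 by omega,
        Nat.mul_le_mul_right ((n / 3) ^ 2) (show 16 ≤ n / 3 by omega)]
  refine absurd (Nat.three_mul_pow_sqrt_lt hn hj2 hj3) (not_lt.2 ?_)
  have hup := Nat.choose_le_pow_sqrt_mul_four_pow (by omega : 9 ≤ n) hkn h
  have hmono := Nat.choose_le_choose_of_le_half (min_le_left k (n / 3)) hkn
  have h6 := Nat.six_pow_le_three_mul_choose j
  have hc := Nat.choose_mul_pow_le hj3 j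
  refine le_of_mul_le_mul_left (a := 3 ^ j) ?_ (by positivity)
  calc 3 ^ j * (2 * n) ^ j = 6 ^ j * n ^ j := by
        rw [← mul_pow, ← mul_pow]; ring
    _ ≤ 3 * (3 * j).choose j * n ^ j := Nat.mul_le_mul_right _ h6
    _ = 3 * ((3 * j).choose j * n ^ j) := by ring
    _ ≤ 3 * (n.choose j * (3 * j) ^ j) := Nat.mul_le_mul_left _ hc
    _ ≤ 3 * ((n ^ n.sqrt * 4 ^ j) * (3 * j) ^ j) := by
        have := hmono.trans hup
        gcongr
    _ = 3 ^ j * (3 * (n ^ n.sqrt * 4 ^ j) * j ^ j) := by rw [mul_pow]; ring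

/-- The **Sylvester–Schur theorem**: if `2 * k ≤ n`, one of the `k` consecutive integers
`n - k + 1, …, n` has a prime factor exceeding `k`. -/
theorem Nat.exists_prime_gt_dvd_sub {n k : ℕ} (hk : 0 < k) (hkn : 2 * k ≤ n) :
    ∃ p, p.Prime ∧ k < p ∧ ∃ i < k, p ∣ n - i := by
  rcases eq_or_ne k 1 with rfl | hk1
  · obtain ⟨p, hp, hd⟩ := Nat.exists_prime_and_dvd (show n ≠ 1 by omega)
    exact ⟨p, hp, hp.one_lt, 0, one_pos, by simpa using hd⟩
  by_cases h : ∃ p, p.Prime ∧ k < p ∧ p ∣ n.choose k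
  · obtain ⟨p, hp, hkp, hd⟩ := h
    refine ⟨p, hp, hkp, ?_⟩
    have h1 : p ∣ n.descFactorial k := by
      rw [Nat.descFactorial_eq_factorial_mul_choose]
      exact hd.mul_left _
    rw [Nat.descFactorial_eq_prod_range, hp.prime.dvd_finsetProd_iff] at h1
    obtain ⟨i, hi, hd⟩ := h1
    exact ⟨i, Finset.mem_range.1 hi, hd⟩
  have hle : ∀ p, p.Prime → p ∣ n.choose k → p ≤ k := fun p hp hd =>
    not_lt.1 fun hlt => h ⟨p, hp, hlt, hd⟩
  rcases lt_or_ge k 37 with hk37 | hk37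
  · obtain ⟨p, hp, h1, h2⟩ := Nat.exists_prime_mod_lt_of_small (by omega) hk37 hkn
      (Nat.pow_sub_primeCounting_le hk (by omega) hle)
    exact ⟨p, hp, h1, n % p, h2, Nat.dvd_sub_mod n⟩
  have h2 := Nat.sq_le_cube_of_choose hk37 (by omega) hle
  rcases lt_or_ge n 65536 with hn | hn
  · obtain ⟨p, hp, hpn, h3⟩ := Nat.exists_prime_near (by omega) hn
    have h4 : n - p < k := by
      rcases hpn.eq_or_lt with rfl | hlt
      · omega
      · refine lt_of_pow_lt_pow_left₀ 3 (by omega) ?_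
        exact (h3.trans_lt (Nat.pow_lt_pow_left hlt (by norm_num))).trans_le h2
    exact ⟨p, hp, by omega, n - p, h4, by rw [Nat.sub_sub_self hpn]⟩
  · exact absurd (Nat.exists_prime_gt_dvd_choose_of_large hn hkn h2) h

/-! ### Primes dividing the constant term of an integral factor -/

/-- Legendre's formula, with a digit sum of at least 1. The resulting `i - 1` leaves a spare power
of `X` later. -/
theorem Nat.factorization_factorial_le_pred_div {p : ℕ} (hp : p.Prime) {i : ℕ} (hi : 0 < i) :
    i.factorial.factorization p ≤ (i - 1) / (p - 1) := by
  have hp1 : 0 < p - 1 := Nat.sub_pos_of_lt hp.one_lt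
  rw [Nat.le_div_iff_mul_le hp1, mul_comm, Nat.sub_one_mul_factorization_factorial hp]
  have : 0 < (p.digits i).sum := by
    rw [Nat.pos_iff_ne_zero]
    intro h
    have hmod := Nat.modEq_digits_sum p (p + 1) (by simp [Nat.mod_eq_of_lt hp.one_lt]) i
    have h0 : ∀ d ∈ p.digits i, d = 0 := List.sum_eq_zero_iff.1 h
    have hne : p.digits i ≠ [] := Nat.digits_ne_nil_iff_ne_zero.2 hi.ne'
    exact Nat.getLast_digit_ne_zero p hi.ne' (h0 _ (List.getLast_mem hne))
  omega

/-- The integral polynomial `n! * ∑ c i x ^ i / i!`. -/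
noncomputable def intExpSum (n : ℕ) (c : ℕ → ℤ) : ℤ[X] :=
  ∑ i ∈ Finset.range (n + 1), C (c i * ((n.factorial / i.factorial : ℕ) : ℤ)) * X ^ i

theorem map_intExpSum (n : ℕ) (c : ℕ → ℤ) :
    (intExpSum n c).map (algebraMap ℤ ℚ) = C (n.factorial : ℚ) * expSum n c := by
  rw [intExpSum, expSum, Polynomial.map_sum, Finset.mul_sum]
  refine Finset.sum_congr rfl fun i hi => ?_
  have hd : i.factorial ∣ n.factorial :=
    Nat.factorial_dvd_factorial (Nat.lt_succ_iff.1 (Finset.mem_range.1 hi))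
  rw [Polynomial.map_mul, Polynomial.map_C, Polynomial.map_pow, Polynomial.map_X, ← mul_assoc,
    ← C_mul]
  congr 2
  have h0 : (i.factorial : ℚ) ≠ 0 := by exact_mod_cast i.factorial_ne_zero
  simp only [eq_intCast, Int.cast_mul, Int.cast_natCast]
  rw [Nat.cast_div hd h0]
  field_simp

theorem coeff_intExpSum {n i : ℕ} (c : ℕ → ℤ) (hi : i ≤ n) :
    (intExpSum n c).coeff i = c i * ((n.factorial / i.factorial : ℕ) : ℤ) := by
  rw [intExpSum, finsetSum_coeff, Finset.sum_eq_single i]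
  · rw [coeff_C_mul_X_pow, if_pos rfl]
  · intro j _ hj
    rw [coeff_C_mul_X_pow, if_neg hj.symm]
  · intro h
    exact absurd (Finset.mem_range.2 (Nat.lt_succ_of_le hi)) h

theorem natDegree_intExpSum_le (n : ℕ) (c : ℕ → ℤ) : (intExpSum n c).natDegree ≤ n :=
  natDegree_sum_le_of_forall_le _ _ fun _ hi =>
    (natDegree_C_mul_X_pow_le _ _).trans (Nat.lt_succ_iff.1 (Finset.mem_range.1 hi))

theorem monic_intExpSum {n : ℕ} {c : ℕ → ℤ} (hcn : c n = 1) : (intExpSum n c).Monic := by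
  refine monic_of_natDegree_le_of_coeff_eq_one n (natDegree_intExpSum_le n c) ?_
  rw [coeff_intExpSum c le_rfl, hcn, Nat.div_self n.factorial_pos]
  simp

theorem natDegree_intExpSum {n : ℕ} {c : ℕ → ℤ} (hcn : c n = 1) :
    (intExpSum n c).natDegree = n := by
  refine le_antisymm (natDegree_intExpSum_le n c) (le_natDegree_of_ne_zero ?_)
  rw [coeff_intExpSum c le_rfl, hcn, Nat.div_self n.factorial_pos]
  simp

theorem natDegree_expSum {n : ℕ} {c : ℕ → ℤ} (hcn : c n = 1) : (expSum n c).natDegree = n := by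
  have h0 : (n.factorial : ℚ) ≠ 0 := by exact_mod_cast n.factorial_ne_zero
  rw [← natDegree_C_mul h0, ← map_intExpSum,
    natDegree_map_eq_of_injective (algebraMap ℤ ℚ).injective_int, natDegree_intExpSum hcn]

/-- A factor of `expSum n c` over `ℚ` is a scalar multiple of a monic integral factor. -/
theorem exists_monic_dvd_of_dvd_expSum {n : ℕ} {c : ℕ → ℤ} (hcn : c n = 1) {a : ℚ[X]}
    (ha : a ∣ expSum n c) :
    ∃ G : ℤ[X], G.Monic ∧ G ∣ intExpSum n c ∧ G.natDegree = a.natDegree ∧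
      a = C a.leadingCoeff * G.map (algebraMap ℤ ℚ) := by
  have hdvd : a ∣ (intExpSum n c).map (algebraMap ℤ ℚ) := by
    rw [map_intExpSum]
    exact ha.mul_left _
  obtain ⟨G, hG⟩ := IsIntegrallyClosed.eq_map_mul_C_of_dvd ℚ (monic_intExpSum hcn) hdvd
  have ha0 : a ≠ 0 := by
    rintro rfl
    rw [zero_dvd_iff] at hdvd
    exact (monic_intExpSum hcn).map (algebraMap ℤ ℚ) |>.ne_zero hdvd
  have hlead : a.leadingCoeff ≠ 0 := leadingCoeff_ne_zero.2 ha0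
  have hinj : Function.Injective (algebraMap ℤ ℚ) := (algebraMap ℤ ℚ).injective_int
  have hmonic : (G.map (algebraMap ℤ ℚ)).Monic := by
    have := congrArg leadingCoeff hG
    rw [leadingCoeff_mul, leadingCoeff_C] at this
    exact mul_right_cancel₀ hlead (by rw [this, one_mul])
  have hGm : G.Monic := Polynomial.monic_of_injective hinj hmonic
  refine ⟨G, hGm, ?_, ?_, ?_⟩
  · rw [← hG] at hdvd
    exact (Polynomial.map_dvd_map _ hinj hGm).1 (dvd_of_mul_right_dvd hdvd)
  · conv_rhs => rw [← hG]
    rw [natDegree_mul_C hlead, natDegree_map_eq_of_injective hinj]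
  · rw [mul_comm, hG]

/-- A prime dividing one of the top `m` factors of `n!` divides the constant coefficient of every
monic factor of degree `m`. -/
theorem dvd_coeff_zero_of_dvd_intExpSum {n : ℕ} {c : ℕ → ℤ} (hcn : c n = 1) {p : ℕ}
    (hp : p.Prime) {G : ℤ[X]} (hG : G.Monic) (hdvd : G ∣ intExpSum n c) {i : ℕ}
    (hi : i < G.natDegree) (hpi : p ∣ n - i) : (p : ℤ) ∣ G.coeff 0 := by
  have := Fact.mk hp
  by_contra h0
  obtain ⟨H, hH⟩ := hdvd
  have hHm : H.Monic := hG.of_mul_monic_left (hH ▸ monic_intExpSum hcn)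
  have hdeg : n = G.natDegree + H.natDegree := by
    rw [← hG.natDegree_mul hHm, ← hH, natDegree_intExpSum hcn]
  let φ := Int.castRingHom (ZMod p)
  have hXF : X ^ (n - i) ∣ (intExpSum n c).map φ := by
    rw [X_pow_dvd_iff]
    intro d hd
    rw [coeff_map, coeff_intExpSum c (by omega), eq_intCast, ZMod.intCast_zmod_eq_zero_iff_dvd]
    refine dvd_mul_of_dvd_right ?_ _
    rw [Int.natCast_dvd_natCast]
    refine hpi.trans ?_
    obtain ⟨e, he⟩ := Nat.exists_eq_add_of_lt hd
    refine Nat.dvd_div_of_mul_dvd ?_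
    have h1 : d.factorial * (n - i) ∣ (n - i).factorial := by
      rw [show n - i = (d + e) + 1 by omega, Nat.factorial_succ, mul_comm]
      exact Nat.mul_dvd_mul_left _ (Nat.factorial_dvd_factorial (by omega))
    exact h1.trans (Nat.factorial_dvd_factorial (by omega))
  rw [hH, Polynomial.map_mul] at hXF
  have hcop : IsCoprime (X ^ (n - i)) (G.map φ) := by
    refine IsCoprime.pow_left ((prime_X.coprime_iff_not_dvd).2 ?_)
    rw [X_dvd_iff, coeff_map, eq_intCast, ZMod.intCast_zmod_eq_zero_iff_dvd]
    exact h0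
  have hXH := hcop.dvd_of_dvd_mul_left hXF
  -- The cofactor has degree `n - G.natDegree`, less than `n - i`.
  have hle := natDegree_le_of_dvd hXH (hHm.map φ).ne_zero
  rw [natDegree_X_pow, hHm.natDegree_map] at hle
  omega

/-- A substitute for valuations of roots: modulo `G`, `X ^ (p - 1)` is divisible by `p` up to `U`,
which is prime to `X` modulo `p`. `U` is what remains of `G` modulo `p` once its power of `X` is
removed. -/
theorem exists_mul_pow_eq_mul {p : ℕ} (hp : p.Prime) {G : ℤ[X]} (hG : G.Monic)
    (hdeg : G.natDegree < p) :
    ∃ U V : ℤ[X], ¬ (p : ℤ) ∣ U.coeff 0 ∧ G ∣ U * X ^ (p - 1) - C (p : ℤ) * V := by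
  have := Fact.mk hp
  let φ := Int.castRingHom (ZMod p)
  have hGφ : G.map φ ≠ 0 := (hG.map φ).ne_zero
  obtain ⟨W, hW, hXW⟩ := exists_eq_pow_rootMultiplicity_mul_and_not_dvd (G.map φ) hGφ 0
  rw [C_0, sub_zero] at hW hXW
  set a := rootMultiplicity 0 (G.map φ)
  have ha : a ≤ p - 1 := by
    have := natDegree_le_of_dvd (Dvd.intro _ hW.symm) hGφ
    rw [natDegree_X_pow, hG.natDegree_map] at this
    omega
  obtain ⟨U, rfl⟩ := Polynomial.map_surjective φ (ZMod.ringHom_surjective φ) W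
  have hpd : C (p : ℤ) ∣ U * X ^ a - G := by
    rw [C_dvd_iff_dvd_coeff]
    intro j
    rw [← ZMod.intCast_zmod_eq_zero_iff_dvd, ← eq_intCast φ, ← coeff_map, Polynomial.map_sub,
      Polynomial.map_mul, Polynomial.map_pow, map_X, hW, mul_comm, sub_self, coeff_zero]
  obtain ⟨V, hV⟩ := hpd
  refine ⟨U, V * X ^ (p - 1 - a), ?_, X ^ (p - 1 - a), ?_⟩
  · rwa [X_dvd_iff, coeff_map, eq_intCast, ZMod.intCast_zmod_eq_zero_iff_dvd] at hXW
  · rw [show X ^ (p - 1) = X ^ a * (X : ℤ[X]) ^ (p - 1 - a) by rw [← pow_add]; congr 1; omega]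
    linear_combination X ^ (p - 1 - a) * hV

/-- A prime exceeding the degree of a monic factor of `intExpSum n c` and not dividing `c 0` does
not divide the constant coefficient of the factor. -/
theorem not_dvd_coeff_zero_of_dvd_intExpSum {n : ℕ} {c : ℕ → ℤ} {p : ℕ} (hp : p.Prime)
    (hpc : ¬ (p : ℤ) ∣ c 0) {G : ℤ[X]} (hG : G.Monic) (hdvd : G ∣ intExpSum n c)
    (hdeg : G.natDegree < p) : ¬ (p : ℤ) ∣ G.coeff 0 := by
  intro hp0
  have := Fact.mk hp
  obtain ⟨U, V, hU, hUV⟩ := exists_mul_pow_eq_mul hp hG hdeg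
  set S : ℕ := n.factorial / p ^ n.factorial.factorization p with hS
  have hSp : ¬ p ∣ S := Nat.not_dvd_ordCompl hp n.factorial_ne_zero
  -- each term of positive index is divisible by `n! * X` modulo `G`
  have hterm : ∀ i ∈ Finset.range n, ∃ B : ℤ[X],
      G ∣ C (S : ℤ) * U ^ n * (C (c (i + 1) * ((n.factorial / (i + 1).factorial : ℕ) : ℤ)) *
        X ^ (i + 1)) - C (n.factorial : ℤ) * (X * B) := by
    intro i hi
    rw [Finset.mem_range] at hi
    set t := i / (p - 1) with ht
    have htn : t ≤ n := (Nat.div_le_self _ _).trans hi.le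
    have hdn : (i + 1).factorial ∣ n.factorial := Nat.factorial_dvd_factorial hi
    obtain ⟨e, he⟩ : (i + 1).factorial ∣ p ^ t * S := by
      have h1 := Nat.factorization_factorial_le_pred_div hp (Nat.succ_pos i)
      rw [← Nat.ordProj_mul_ordCompl_eq_self (i + 1).factorial p]
      exact mul_dvd_mul (pow_dvd_pow _ h1) (Nat.ordCompl_dvd_ordCompl_of_dvd hdn p)
    obtain ⟨f, hf⟩ := hdn
    have hif : n.factorial / (i + 1).factorial = f := by
      rw [hf, Nat.mul_div_cancel_left _ (Nat.factorial_pos _)]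
    rw [hif]
    have hti : t * (p - 1) ≤ i := Nat.div_mul_le_self _ _
    obtain ⟨Q, hQ⟩ : G ∣ (U * X ^ (p - 1)) ^ t - (C (p : ℤ) * V) ^ t :=
      hUV.trans (sub_dvd_pow_sub_pow _ _ _)
    -- Trade `t` blocks `U * X ^ (p - 1)` for `p ^ t * V ^ t`; then `p ^ t * S` absorbs `(i + 1)!`,
    -- and at least one `X` is left over.
    refine ⟨C (c (i + 1) * e) * U ^ (n - t) * V ^ t * X ^ (i - t * (p - 1)),
      C (S : ℤ) * C (c (i + 1) * f) * U ^ (n - t) * X ^ (i - t * (p - 1) + 1) * Q, ?_⟩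
    have hUn : U ^ n = U ^ t * U ^ (n - t) := by rw [← pow_add]; congr 1; omega
    have hXn : (X : ℤ[X]) ^ (i + 1) = (X ^ (p - 1)) ^ t * X ^ (i - t * (p - 1) + 1) := by
      rw [← pow_mul, ← pow_add]; congr 1; rw [mul_comm (p - 1)]; omega
    have heC : C (p : ℤ) ^ t * C (S : ℤ) = C (((i + 1).factorial : ℕ) : ℤ) * C (e : ℤ) := by
      rw [← C_pow, ← C_mul, ← C_mul]; congr 1; exact_mod_cast he
    have hfC : C (n.factorial : ℤ) = C (((i + 1).factorial : ℕ) : ℤ) * C (f : ℤ) := by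
      rw [← C_mul]; congr 1; exact_mod_cast hf
    rw [hUn, hXn, hfC, C_mul, C_mul]
    rw [mul_pow, mul_pow] at hQ
    linear_combination (C (S : ℤ) * (C (c (i + 1)) * C (f : ℤ)) * U ^ (n - t) *
      X ^ (i - t * (p - 1) + 1)) * hQ +
      C (c (i + 1)) * C (f : ℤ) * U ^ (n - t) * V ^ t * X ^ (i - t * (p - 1) + 1) * heC
  choose! B hB using hterm
  have hsum : G ∣ C (n.factorial : ℤ) *
      (C (S : ℤ) * U ^ n * C (c 0) + X * ∑ i ∈ Finset.range n, B i) := by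
    have h1 := Finset.dvd_sum hB
    rw [Finset.sum_sub_distrib] at h1
    have h2 : G ∣ C (S : ℤ) * U ^ n * intExpSum n c := hdvd.mul_left _
    rw [intExpSum, Finset.sum_range_succ', mul_add, Finset.mul_sum] at h2
    have h3 := dvd_sub h2 h1
    convert! h3 using 1
    rw [← Finset.mul_sum (f := fun i => X * B i), ← Finset.mul_sum (f := B)]
    simp only [Nat.factorial_zero, Nat.div_one, pow_zero, C_mul]
    ring
  -- The monic `G` is primitive, so by Gauss's lemma `n!` can be cancelled.
  have hcop : G ∣ C (S : ℤ) * U ^ n * C (c 0) + X * ∑ i ∈ Finset.range n, B i := by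
    obtain ⟨Q, hQ⟩ := hsum
    have h1 : C (n.factorial : ℤ) ∣ Q := by
      have h2 : C (n.factorial : ℤ) ∣ G * Q := Dvd.intro _ hQ
      rwa [← dvd_content_iff_C_dvd, content_mul, hG.isPrimitive.content_eq_one, one_mul,
        dvd_content_iff_C_dvd] at h2
    obtain ⟨R, rfl⟩ := h1
    refine ⟨R, mul_left_cancel₀ (C_ne_zero.2 (?_ : (n.factorial : ℤ) ≠ 0)) (hQ.trans (by ring))⟩
    exact_mod_cast n.factorial_ne_zero
  obtain ⟨R, hR⟩ := hcop
  have h0 := congrArg (fun P : ℤ[X] => P.coeff 0) hR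
  simp only [coeff_add, mul_coeff_zero, coeff_C_zero, coeff_X_zero, zero_mul, add_zero] at h0
  have hpp : Prime (p : ℤ) := Nat.prime_iff_prime_int.1 hp
  have hdd : (p : ℤ) ∣ (S : ℤ) * (U ^ n).coeff 0 * c 0 := h0 ▸ hp0.mul_right _
  rcases hpp.dvd_or_dvd hdd with h | h
  · rcases hpp.dvd_or_dvd h with h | h
    · exact hSp (Int.natCast_dvd_natCast.1 h)
    · rw [coeff_zero_eq_eval_zero, eval_pow, ← coeff_zero_eq_eval_zero] at h
      exact hU (hpp.dvd_of_dvd_pow h)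
  · exact hpc h

/-! ### Degrees of the possible factors -/

theorem not_dvd_expSum {n : ℕ} {c : ℕ → ℤ} (hcn : c n = 1) {p : ℕ} (hp : p.Prime)
    (hpc : ¬ (p : ℤ) ∣ c 0) {a : ℚ[X]} {i : ℕ} (hi : i < a.natDegree) (hpi : p ∣ n - i)
    (hdeg : a.natDegree < p) : ¬ a ∣ expSum n c := by
  intro ha
  obtain ⟨G, hG, hd, hGa, -⟩ := exists_monic_dvd_of_dvd_expSum hcn ha
  exact not_dvd_coeff_zero_of_dvd_intExpSum hp hpc hG hd (hGa ▸ hdeg)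
    (dvd_coeff_zero_of_dvd_intExpSum hcn hp hG hd (hGa ▸ hi) hpi)

theorem Nat.Prime.not_dvd_of_eq_two_pow {z : ℤ} {k : ℕ} (hz : z = 2 ^ k ∨ z = -2 ^ k) {p : ℕ}
    (hp : p.Prime) (hp2 : p ≠ 2) : ¬ (p : ℤ) ∣ z := by
  intro h
  have h1 : (p : ℤ) ∣ 2 ^ k := by
    rcases hz with rfl | rfl
    · exact h
    · exact (dvd_neg.1 h)
  have h2 : p ∣ 2 ^ k := by exact_mod_cast h1
  exact hp2 ((Nat.prime_dvd_prime_iff_eq hp Nat.prime_two).1 (hp.dvd_of_dvd_pow h2))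

theorem Nat.exists_eq_two_pow {n : ℕ} (hn : n ≠ 0) (h : ∀ p, p.Prime → p ≠ 2 → ¬ p ∣ n) :
    ∃ s, n = 2 ^ s :=
  ⟨_, Nat.eq_prime_pow_of_unique_prime_dvd hn fun {d} hd hdn => by
    by_contra h2
    exact h d hd h2 hdn⟩

theorem not_dvd_expSum_of_two_le {n : ℕ} {c : ℕ → ℤ} (hcn : c n = 1) {k : ℕ}
    (hc0 : c 0 = 2 ^ k ∨ c 0 = -2 ^ k) {a : ℚ[X]} (h2 : 2 ≤ a.natDegree)
    (hn : 2 * a.natDegree ≤ n) : ¬ a ∣ expSum n c := by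
  obtain ⟨p, hp, hap, i, hi, hpi⟩ := Nat.exists_prime_gt_dvd_sub (by omega) hn
  exact not_dvd_expSum hcn hp (hp.not_dvd_of_eq_two_pow hc0 (by omega)) hi hpi hap

theorem not_dvd_expSum_of_natDegree_eq_one {n : ℕ} (hn : 2 ≤ n) {c : ℕ → ℤ} (hcn : c n = 1) {k : ℕ}
    (hc0 : c 0 = 2 ^ k ∨ c 0 = -2 ^ k)
    (h : (¬ ∃ s : ℕ, 0 < s ∧ n = 2 ^ s) ∨ c 0 = 1 ∨ c 0 = -1) {a : ℚ[X]}
    (ha : a.natDegree = 1) : ¬ a ∣ expSum n c := by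
  obtain ⟨p, hp, hpn, hpc⟩ : ∃ p : ℕ, p.Prime ∧ p ∣ n ∧ ¬ (p : ℤ) ∣ c 0 := by
    rcases h with h | h
    · by_contra! hno
      obtain ⟨s, rfl⟩ := Nat.exists_eq_two_pow (n := n) (by omega) fun p hp hp2 hpn =>
        hp.not_dvd_of_eq_two_pow hc0 hp2 (hno p hp hpn)
      refine h ⟨s, Nat.pos_of_ne_zero ?_, rfl⟩
      rintro rfl
      omega
    · obtain ⟨p, hp, hpn⟩ := Nat.exists_prime_and_dvd (show n ≠ 1 by omega)
      refine ⟨p, hp, hpn, fun hd => (Nat.prime_iff_prime_int.1 hp).not_isUnit ?_⟩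
      exact isUnit_of_dvd_unit hd (Int.isUnit_iff.2 h)
  exact not_dvd_expSum hcn hp hpc (i := 0) (by omega) (by simpa using hpn)
    (by rw [ha]; exact hp.one_lt)

/-- Every prime exceeds the degree 1, so no odd prime divides the constant term of the monic
integral factor. -/
theorem eq_of_natDegree_eq_one_of_dvd_expSum {n : ℕ} {c : ℕ → ℤ} (hcn : c n = 1) {k : ℕ}
    (hc0 : c 0 = 2 ^ k ∨ c 0 = -2 ^ k) {a : ℚ[X]} (ha : a.natDegree = 1)
    (hd : a ∣ expSum n c) :
    ∃ (ε : ℤˣ) (t : ℕ), a = C a.leadingCoeff * (X + C (((ε : ℤ) : ℚ) * 2 ^ t)) := by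
  obtain ⟨G, hG, hGd, hGa, heq⟩ := exists_monic_dvd_of_dvd_expSum hcn hd
  have hno : ∀ p : ℕ, p.Prime → p ≠ 2 → ¬ p ∣ (G.coeff 0).natAbs := fun p hp hp2 hpr =>
    not_dvd_coeff_zero_of_dvd_intExpSum hp (hp.not_dvd_of_eq_two_pow hc0 hp2) hG hGd
      (by rw [hGa, ha]; exact hp.one_lt) (Int.natCast_dvd.2 hpr)
  obtain ⟨t, ht⟩ := Nat.exists_eq_two_pow (n := (G.coeff 0).natAbs)
    (fun h0 => hno 3 Nat.prime_three (by norm_num) (by rw [h0]; exact dvd_zero 3)) hno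
  have hGX : G = X + C (G.coeff 0) := hG.eq_X_add_C (hGa.trans ha)
  obtain ⟨ε, hε⟩ : ∃ ε : ℤˣ, G.coeff 0 = ε * 2 ^ t := by
    rcases Int.natAbs_eq (G.coeff 0) with h | h
    · exact ⟨1, by rw [h, ht]; simp⟩
    · exact ⟨-1, by rw [h, ht]; simp⟩
  refine ⟨ε, t, heq.trans ?_⟩
  congr 1
  rw [hGX, hε, Polynomial.map_add, map_X, map_C]
  simp

/-- If `expSum n c` splits off a factor of degree at most that of its cofactor, the factor is
linear. -/
theorem natDegree_eq_one_of_mul_eq_expSum {n : ℕ} (hn : 2 ≤ n) {c : ℕ → ℤ} (hcn : c n = 1) {k : ℕ}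
    (hc0 : c 0 = 2 ^ k ∨ c 0 = -2 ^ k) {a b : ℚ[X]} (hab : expSum n c = a * b)
    (ha : ¬ IsUnit a) (hle : a.natDegree ≤ b.natDegree) : a.natDegree = 1 := by
  have hf : expSum n c ≠ 0 := by
    intro h
    have := natDegree_expSum hcn
    rw [h, natDegree_zero] at this
    omega
  have ha0 : a ≠ 0 := fun h => hf (by rw [hab, h, zero_mul])
  have hb0 : b ≠ 0 := fun h => hf (by rw [hab, h, mul_zero])
  have hdeg : n = a.natDegree + b.natDegree := by
    rw [← natDegree_mul ha0 hb0, ← hab, natDegree_expSum hcn]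
  have hpos : 0 < a.natDegree := natDegree_pos_iff_degree_pos.2
    (degree_pos_of_ne_zero_of_nonunit ha0 ha)
  by_contra h1
  exact not_dvd_expSum_of_two_le hcn hc0 (by omega) (by omega) (Dvd.intro _ hab.symm)

theorem irreducible_expSum {n : ℕ} (hn : 2 ≤ n) {c : ℕ → ℤ} (hcn : c n = 1) {k : ℕ}
    (hc0 : c 0 = 2 ^ k ∨ c 0 = -2 ^ k)
    (h : (¬ ∃ s : ℕ, 0 < s ∧ n = 2 ^ s) ∨ c 0 = 1 ∨ c 0 = -1) : Irreducible (expSum n c) := by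
  refine ⟨not_isUnit_of_natDegree_pos _ (by rw [natDegree_expSum hcn]; omega), fun a b hab => ?_⟩
  by_contra! hu
  rcases le_total a.natDegree b.natDegree with hle | hle
  · exact not_dvd_expSum_of_natDegree_eq_one hn hcn hc0 h
      (natDegree_eq_one_of_mul_eq_expSum hn hcn hc0 hab hu.1 hle) (Dvd.intro _ hab.symm)
  · rw [mul_comm] at hab
    exact not_dvd_expSum_of_natDegree_eq_one hn hcn hc0 h
      (natDegree_eq_one_of_mul_eq_expSum hn hcn hc0 hab hu.2 hle) (Dvd.intro _ hab.symm)

theorem exists_mul_eq_of_not_irreducible_expSum {n : ℕ} (hn : 2 ≤ n) {c : ℕ → ℤ} (hcn : c n = 1)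
    {k : ℕ} (hc0 : c 0 = 2 ^ k ∨ c 0 = -2 ^ k) (hirr : ¬ Irreducible (expSum n c)) :
    ∃ a b : ℚ[X], expSum n c = a * b ∧ a.natDegree = 1 ∧ Irreducible b ∧
      n = b.natDegree + 1 := by
  have hdeg := natDegree_expSum hcn
  obtain ⟨a, b, hab, ha, hle⟩ : ∃ a b : ℚ[X], expSum n c = a * b ∧ ¬ IsUnit a ∧
      a.natDegree ≤ b.natDegree := by
    rw [irreducible_iff] at hirr
    push Not at hirr
    obtain ⟨a, b, hab, ha, hb⟩ :=
      hirr (not_isUnit_of_natDegree_pos _ (by rw [hdeg]; omega))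
    rcases le_total a.natDegree b.natDegree with hle | hle
    · exact ⟨a, b, hab, ha, hle⟩
    · exact ⟨b, a, hab.trans (mul_comm a b), hb, hle⟩
  have ha1 := natDegree_eq_one_of_mul_eq_expSum hn hcn hc0 hab ha hle
  have hf0 : a * b ≠ 0 := by
    rw [← hab]
    exact ne_zero_of_natDegree_gt (n := 0) (by rw [hdeg]; omega)
  have hnb : n = b.natDegree + 1 := by
    rw [← hdeg, hab, natDegree_mul (left_ne_zero_of_mul hf0) (right_ne_zero_of_mul hf0), ha1,
      add_comm]
  refine ⟨a, b, hab, ha1, ?_, hnb⟩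
  rcases eq_or_ne n 2 with rfl | hn2
  · exact irreducible_of_degree_eq_one
      ((degree_eq_iff_natDegree_eq_of_pos one_pos).2 (by omega))
  -- Makes degree 2 at most `n / 2`; `n = 3` is not a power of 2, hence irreducible.
  have hn4 : 4 ≤ n := by
    by_contra hlt
    refine hirr (irreducible_expSum hn hcn hc0 (Or.inl ?_))
    rintro ⟨s, hs, h⟩
    obtain rfl : n = 3 := by omega
    exact absurd (h ▸ dvd_pow_self 2 hs.ne' : 2 ∣ 3) (by norm_num)
  -- a nontrivial factor of `b` of least degree is linear, and with `a` it makes a quadratic factor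
  have key : ∀ u v : ℚ[X], b = u * v → ¬ IsUnit u → u.natDegree ≤ v.natDegree → False := by
    intro u v huv hu hle
    have hb0 : u * v ≠ 0 := huv ▸ right_ne_zero_of_mul hf0
    have hu0 := left_ne_zero_of_mul hb0
    have hdv : b.natDegree = u.natDegree + v.natDegree := by
      rw [huv, natDegree_mul hu0 (right_ne_zero_of_mul hb0)]
    have hu1 := natDegree_eq_one_of_mul_eq_expSum hn hcn hc0 (a := u) (b := v * a)
      (by rw [hab, huv]; ring) hu (by
        rw [natDegree_mul (right_ne_zero_of_mul hb0) (left_ne_zero_of_mul hf0)]; omega)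
    have hau : (a * u).natDegree = 2 := by
      rw [natDegree_mul (left_ne_zero_of_mul hf0) hu0, ha1, hu1]
    exact not_dvd_expSum_of_two_le hcn hc0 hau.ge (by omega)
      (Dvd.intro v (by rw [hab, huv, mul_assoc]))
  refine ⟨not_isUnit_of_natDegree_pos _ (by omega), fun u v huv => ?_⟩
  by_contra! hno
  rcases le_total u.natDegree v.natDegree with hle | hle
  · exact key u v huv hno.1 hle
  · exact key v u (huv.trans (mul_comm u v)) hno.2 hle

theorem theorem1p1 (n : ℕ) (hn : 2 ≤ n) (c : ℕ → ℤ) (hcn : c n = 1)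
    (k : ℕ) (hc0 : c 0 = 2 ^ k ∨ c 0 = -2 ^ k) :
    (Irreducible (expSum n c) ∨
      ∃ g : ℚ[X], Irreducible g ∧
        (n < 2 * g.natDegree ∨ (n = 2 ∧ g.natDegree = 1)) ∧ g.natDegree < n ∧
        ∃ (ε : Fin (n - g.natDegree) → ℤˣ) (t : Fin (n - g.natDegree) → ℕ),
          expSum n c = g * ∏ i, (X + C (((ε i : ℤ) : ℚ) * 2 ^ t i))) ∧
    (((¬ ∃ s : ℕ, 0 < s ∧ n = 2 ^ s) ∨ c 0 = 1 ∨ c 0 = -1) →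
      Irreducible (expSum n c)) := by
  refine ⟨?_, irreducible_expSum hn hcn hc0⟩
  by_cases hirr : Irreducible (expSum n c)
  · exact Or.inl hirr
  obtain ⟨a, b, hab, ha, hb, hnb⟩ := exists_mul_eq_of_not_irreducible_expSum hn hcn hc0 hirr
  obtain ⟨ε, t, hεt⟩ := eq_of_natDegree_eq_one_of_dvd_expSum hcn hc0 ha (Dvd.intro _ hab.symm)
  have ha0 : a.leadingCoeff ≠ 0 :=
    leadingCoeff_ne_zero.2 (ne_zero_of_natDegree_gt (n := 0) (by omega))
  have hdeg : (C a.leadingCoeff * b).natDegree = b.natDegree := natDegree_C_mul ha0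
  -- The leading coefficient of the linear factor moves into `g`.
  refine Or.inr ⟨C a.leadingCoeff * b, ?_, ?_, ?_, fun _ => ε, fun _ => t, ?_⟩
  · exact (irreducible_isUnit_mul (isUnit_C.2 ha0.isUnit)).2 hb
  · rw [hdeg]; omega
  · rw [hdeg]; omega
  · rw [Finset.prod_const, Finset.card_univ, Fintype.card_fin, hdeg,
      show n - b.natDegree = 1 by omega, pow_one, hab]
    conv_lhs => rw [hεt]
    ring
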